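/- For an integrable function $q:[0,1]\to\mathbb{C}$ write $(f,g)=\int_0^1 f(x)\overline{g(x)}\,dx$ and $q_m=(q,e^{i2\pi mx})$ for $m\in\mathbb{Z}$. Let $L_1^{+}[0,1]$ (respectively $L_1^{-}[0,1]$) be the set of $q\in L_1[0,1]$ with $q_m=0$ for all $m\le 0$ (respectively for all $m\ge 0$). For $t\in\mathbb{C}$ let $L_t(q)$ be the operator generated in $L_2[0,1]$ by the expression $-y''+qy$ and the boundary conditions $y(1)=e^{it}y(0)$, $y'(1)=e^{it}y'(0)$. Theorem 2. Let $q\in L_1^{+}[0,1]$, $n\in\mathbb{Z}$, and $t\in\mathbb{C}$ with $t\ne\pi k$ for all $k\in\mathbb{Z}$. Then $L_t(q)$ has an eigenfunction $\Psi_{n,t}$ corresponding to the eigenvalue $(2\pi n+t)^2$ and normalized by $$(\Psi_{n,t},e^{i(2\pi n+\overline{t})x})=1,$$ and every such normalized eigenfunction satisfies, for all $x\in[0,1]$, $$\Psi_{n,t}(x)=e^{i(2\pi n+t)x}+\sum_{p\in\mathbb{N}}c_{p,n}(t)\,e^{i(2\pi(n+p)+t)x},$$ where $\mathbb{N}=\{1,2,\dots\}$,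 the series converges absolutely, and $$c_{p,n}(t)=d_{p,n}(t)\left(q_p+\sum_{k=1}^{|p|-1}\ \sum_{n_1,\dots,n_k}\frac{q_{n_1}q_{n_2}\cdots q_{n_k}\,q_{p-n(k)}}{\prod_{s=1}^{k}\bigl(2\pi(2n+p-n(s))+2t\bigr)\,2\pi\,(n(s)-p)}\right),$$ $$d_{p,n}(t)=-\bigl(2\pi p\,(2\pi(2n+p)+2t)\bigr)^{-1},\qquad n(s)=n_1+n_2+\cdots+n_s,$$ the inner sum being over all integers $n_1,\dots,n_k$ with $\{n_1,\dots,n_k,\,p-n(k)\}\subset\mathbb{N}$. In particular the normalized eigenfunction is unique. The theorem continues to hold if $L_1^{+}[0,1]$ is replaced by $L_1^{-}[0,1]$ and $\mathbb{N}$, both in the series over $p$ and in the condition on the indices, is replaced by $-\mathbb{N}=\{-1,-2,\dots\}$. -/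

import Mathlib

open MeasureTheory Set Complex
open scoped ComplexConjugate

noncomputable section

namespace Hill

/-- The (extended) `L₂[0,1]` pairing `(f, g) = ∫₀¹ f(x) conj(g(x)) dx`. -/
def pairing (f g : ℝ → ℂ) : ℂ := ∫ x in (0 : ℝ)..1, f x * conj (g x)

/-- The exponential `x ↦ e^{iμx}` with complex frequency `μ`. -/
def expo (μ : ℂ) (x : ℝ) : ℂ := exp (I * μ * x)

/-- The Fourier coefficient `q_m = (q, e^{i2πmx})`. -/
def qCoeff (q : ℝ → ℂ) (m : ℤ) : ℂ := pairing q (expo (2 * Real.pi * m))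

/-- `L₁⁺[0,1]`: complex-valued integrable functions on `[0,1]` with `q_m = 0` for all `m ≤ 0`.
Only the values on `[0,1]` matter. -/
def L1Plus : Set (ℝ → ℂ) :=
  {q | IntegrableOn q (Icc 0 1) volume ∧ ∀ m : ℤ, m ≤ 0 → qCoeff q m = 0}

/-- `L₁⁻[0,1]`: complex-valued integrable functions on `[0,1]` with `q_m = 0` for all `m ≥ 0`. -/
def L1Minus : Set (ℝ → ℂ) :=
  {q | IntegrableOn q (Icc 0 1) volume ∧ ∀ m : ℤ, 0 ≤ m → qCoeff q m = 0}

/-- The derivative of a function on the interval `[0,1]` (one-sided at the end points). -/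
def D (y : ℝ → ℂ) : ℝ → ℂ := derivWithin y (Icc 0 1)

/-- The differential expression `-y'' + q y` on `[0,1]`. -/
def expr (q y : ℝ → ℂ) (x : ℝ) : ℂ := -D (D y) x + q x * y x

/-- The domain of the operator `L_t(q)` generated in `L₂[0,1]` by `-y'' + q y` and the
quasi-periodic boundary conditions: `y` is differentiable on `[0,1]`, `y'` is absolutely
continuous there (so `y''` exists almost everywhere), `-y'' + q y ∈ L₂[0,1]`, and
`y(1) = e^{it} y(0)`, `y'(1) = e^{it} y'(0)`. -/
structure InDomain (q : ℝ → ℂ) (t : ℂ) (y : ℝ → ℂ) : Prop where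
  differentiableOn : DifferentiableOn ℝ y (Icc 0 1)
  absolutelyContinuous : AbsolutelyContinuousOnInterval (D y) 0 1
  memLp : MemLp (expr q y) 2 (volume.restrict (Icc 0 1))
  boundary : y 1 = exp (I * t) * y 0
  boundary_deriv : D y 1 = exp (I * t) * D y 0

/-- `y` is an eigenfunction of `L_t(q)` corresponding to the eigenvalue `lam`. -/
structure IsEigenfunction (q : ℝ → ℂ) (t lam : ℂ) (y : ℝ → ℂ) : Prop where
  inDomain : InDomain q t y
  eq : ∀ᵐ x ∂(volume.restrict (Icc (0 : ℝ) 1)), expr q y x = lam * y x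
  ne_zero : ∃ x ∈ Icc (0 : ℝ) 1, y x ≠ 0

/-- `Ψ` is an eigenfunction of `L_t(q)` corresponding to `(2πn+t)²`, normalized by
`(Ψ, e^{i(2πn + conj t)x}) = 1`. -/
structure IsNormalizedEigenfunction (q : ℝ → ℂ) (t : ℂ) (n : ℤ) (Ψ : ℝ → ℂ) : Prop where
  isEigenfunction : IsEigenfunction q t ((2 * Real.pi * n + t) ^ 2) Ψ
  normalized : pairing Ψ (expo (2 * Real.pi * n + conj t)) = 1

/-- `d_{p,n}(t) = -(2πp (2π(2n+p) + 2t))⁻¹`. -/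
def d (p n : ℤ) (t : ℂ) : ℂ :=
  -(2 * Real.pi * p * (2 * Real.pi * (2 * n + p) + 2 * t))⁻¹

/-- The partial sum `v_0 + ⋯ + v_s` (entries are numbered from `0`). -/
def partialSum {k : ℕ} (v : Fin k → ℤ) (s : Fin k) : ℤ := ∑ i ∈ Finset.Iic s, v i

/-- The summand of the coefficient formula belonging to the tuple `(n_1, …, n_k)`. -/
def term (q : ℝ → ℂ) (t : ℂ) (n p : ℤ) {k : ℕ} (v : Fin k → ℤ) : ℂ :=
  ((∏ i, qCoeff q (v i)) * qCoeff q (p - ∑ i, v i)) /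
    ∏ s, ((2 * Real.pi * (2 * n + p - partialSum v s) + 2 * t) *
      (2 * Real.pi * (partialSum v s - p)))

/-- The tuples `(n_1, …, n_k)` with `n_1, …, n_k, p - n_1 - ⋯ - n_k` all in `{1, 2, …}`. -/
def posTuples (p : ℤ) (k : ℕ) : Finset (Fin k → ℤ) :=
  (Fintype.piFinset fun _ => Finset.Icc 1 (p - 1)).filter fun v => 1 ≤ p - ∑ i, v i

/-- The tuples `(n_1, …, n_k)` with `n_1, …, n_k, p - n_1 - ⋯ - n_k` all in `{-1, -2, …}`. -/
def negTuples (p : ℤ) (k : ℕ) : Finset (Fin k → ℤ) :=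
  (Fintype.piFinset fun _ => Finset.Icc (p + 1) (-1)).filter fun v => p - ∑ i, v i ≤ -1

theorem mem_posTuples {p : ℤ} {k : ℕ} {v : Fin k → ℤ} :
    v ∈ posTuples p k ↔ (∀ i, 1 ≤ v i) ∧ 1 ≤ p - ∑ i, v i := by
  simp only [posTuples, Finset.mem_filter, Fintype.mem_piFinset, Finset.mem_Icc]
  refine ⟨fun h => ⟨fun i => (h.1 i).1, h.2⟩, fun h => ⟨fun i => ⟨h.1 i, ?_⟩, h.2⟩⟩
  have := Finset.single_le_sum (f := v) (fun j _ => by linarith [h.1 j]) (Finset.mem_univ i)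
  linarith [h.2]

theorem mem_negTuples {p : ℤ} {k : ℕ} {v : Fin k → ℤ} :
    v ∈ negTuples p k ↔ (∀ i, v i ≤ -1) ∧ p - ∑ i, v i ≤ -1 := by
  simp only [negTuples, Finset.mem_filter, Fintype.mem_piFinset, Finset.mem_Icc]
  refine ⟨fun h => ⟨fun i => (h.1 i).2, h.2⟩, fun h => ⟨fun i => ⟨?_, h.1 i⟩, h.2⟩⟩
  have := Finset.single_le_sum (f := fun j => -v j) (fun j _ => by linarith [h.1 j])
    (Finset.mem_univ i)
  simp only [Finset.sum_neg_distrib] at this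
  linarith [h.2]

/-- `c_{p,n}(t)` for `p = 1, 2, …`, with all indices positive. -/
def cPlus (q : ℝ → ℂ) (t : ℂ) (n p : ℤ) : ℂ :=
  d p n t * (qCoeff q p +
    ∑ k ∈ Finset.Icc 1 (p.natAbs - 1), ∑ v ∈ posTuples p k, term q t n p v)

/-- `c_{p,n}(t)` for `p = -1, -2, …`, with all indices negative. -/
def cMinus (q : ℝ → ℂ) (t : ℂ) (n p : ℤ) : ℂ :=
  d p n t * (qCoeff q p +
    ∑ k ∈ Finset.Icc 1 (p.natAbs - 1), ∑ v ∈ negTuples p k, term q t n p v)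

end Hill

end

/-!
Write `μ_p = 2π(n + p) + t`, so that the eigenvalue in question is `μ_0²`, and let
`Y_p = ∫₀¹ Ψ(x) e^{-iμ_p x} dx`. Integrating `-Ψ'' + qΨ = μ_0² Ψ` twice by parts against
`e^{-iμ_p x}` (the quasi-periodic boundary conditions kill the boundary terms) gives
`(μ_p² - μ_0²) Y_p = -∫₀¹ qΨ e^{-iμ_p x}`, and since `Y_p = O(p⁻²)`, the series
`Ψ = ∑ Y_k e^{iμ_k x}` converges absolutely and the right hand side is `-∑_k q_{p-k} Y_k`. As
`t ∉ πℤ`, for `p ≠ 0` this reads `Y_p = d_{p,n}(t) ∑_k q_{p-k} Y_k`, with summable `d_{p,n}(t)`.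

For `q ∈ L₁⁺` only the terms `k < p` are present. The tail sums `S_N = ∑_{k ≤ N} |Y_k|` then satisfy
`S_N ≤ (‖q‖₁ ∑_{k ≤ N} |d_k|) S_N`, whence `S_N = 0` for `N` near `-∞`, and the recursion
propagates the zeros up to `p = -1` (`Hill.eq_zero_of_neg`). The normalization is `Y_0 = 1`, and the
recursion determines `Y_p` for `p ≥ 1`; unfolding it produces the sum over tuples
(`Hill.recCoeff_eq`, `Hill.eq_recCoeff_of_pos`).

Conversely, the sequence defined by the recursion is summable, by a discrete Gronwall estimate
(`Hill.summable_norm_recSeq`). If `u` is the sum of the corresponding series, the equation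
`z'' = qu - μ_0² u` has a quasi-periodic solution `z`, because `e^{it} ≠ 1`; comparing Fourier
coefficients gives `z = u`, so `z` is an eigenfunction (`Hill.exists_isEigenfunction`).

The class `L₁⁻` is reached by reflecting all indices. Both cases are the same statement for an
automorphism `e` of `ℤ` (`Hill.exists_normalizedEigenfunction_and_hasSum`).
-/

noncomputable section

namespace Hill

/-! ### The recursion and its solution as a sum over tuples -/

/-- The summand belonging to a tuple `v` in the solution of the recursion
`Y p = δ p * ∑ k, Q (p - k) * Y k`: a step of length `v i` contributes `Q (v i)`, and each index
`p - partialSum v s` visited on the way down from `p` to `0` contributes its `δ`. -/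
def recTerm (Q δ : ℤ → ℂ) (p : ℤ) {k : ℕ} (v : Fin k → ℤ) : ℂ :=
  (∏ i, Q (v i)) * Q (p - ∑ i, v i) * ∏ s, δ (p - partialSum v s)

/-- The closed form of the value at `p ≥ 1` of the solution of `Y p = δ p * ∑ k, Q (p - k) * Y k`
with `Y 0 = 1` and `Y k = 0` for `k < 0`. -/
def recCoeff (Q δ : ℤ → ℂ) (p : ℤ) : ℂ :=
  δ p * (Q p + ∑ k ∈ Finset.Icc 1 (p.natAbs - 1), ∑ v ∈ posTuples p k, recTerm Q δ p v)

theorem partialSum_cons_zero {k : ℕ} (m : ℤ) (w : Fin k → ℤ) :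
    partialSum (Fin.cons m w : Fin (k + 1) → ℤ) 0 = m := by
  have : Finset.Iic (0 : Fin (k + 1)) = {0} := by ext i; simp
  simp [partialSum, this]

theorem partialSum_cons_succ {k : ℕ} (m : ℤ) (w : Fin k → ℤ) (s : Fin k) :
    partialSum (Fin.cons m w : Fin (k + 1) → ℤ) s.succ = m + partialSum w s := by
  have : Finset.Iic s.succ = insert 0 ((Finset.Iic s).map (Fin.succEmb k)) := by
    ext i
    cases i using Fin.cases <;> simp
  rw [partialSum, this, Finset.sum_insert (by simp), Finset.sum_map]
  simp [partialSum]

/-- Splitting off the first step of a tuple is one application of the recursion. -/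
theorem recTerm_cons (Q δ : ℤ → ℂ) (p m : ℤ) {k : ℕ} (w : Fin k → ℤ) :
    recTerm Q δ p (Fin.cons m w : Fin (k + 1) → ℤ) =
      Q m * (δ (p - m) * recTerm Q δ (p - m) w) := by
  simp only [recTerm, Fin.prod_univ_succ, Fin.sum_univ_succ, Fin.cons_zero, Fin.cons_succ,
    partialSum_cons_zero, partialSum_cons_succ, sub_sub]
  ring

theorem posTuples_eq_empty {p : ℤ} {k : ℕ} (h : p ≤ k) : posTuples p k = ∅ := by
  refine Finset.eq_empty_of_forall_notMem fun v hv => ?_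
  obtain ⟨h1, h2⟩ := mem_posTuples.1 hv
  have : ∑ _i : Fin k, (1 : ℤ) ≤ ∑ i, v i := Finset.sum_le_sum fun i _ => h1 i
  simp at this
  linarith

/-- A tuple of length `k + 1` for `p` is a first entry `m` followed by a tuple of length `k` for
`p - m`. -/
theorem sum_posTuples_succ (p : ℤ) (k : ℕ) (f : (Fin (k + 1) → ℤ) → ℂ) :
    ∑ v ∈ posTuples p (k + 1), f v =
      ∑ m ∈ Finset.Icc 1 (p - 1), ∑ w ∈ posTuples (p - m) k, f (Fin.cons m w) := by
  rw [Finset.sum_sigma']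
  refine Finset.sum_bij' (fun v _ => ⟨v 0, Fin.tail v⟩) (fun x _ => Fin.cons x.1 x.2)
    (fun v hv => ?_) (fun x hx => ?_) (fun v _ => by simp) (fun x _ => by simp) (fun v _ => by simp)
  · obtain ⟨h1, h2⟩ := mem_posTuples.1 hv
    rw [Fin.sum_univ_succ] at h2
    have : 0 ≤ ∑ i : Fin k, v i.succ := Finset.sum_nonneg fun i _ => by linarith [h1 i.succ]
    simp only [Finset.mem_sigma, Finset.mem_Icc, mem_posTuples, Fin.tail]
    exact ⟨⟨h1 0, by linarith⟩, fun i => h1 i.succ, by linarith⟩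
  · simp only [Finset.mem_sigma, Finset.mem_Icc, mem_posTuples] at hx
    rw [mem_posTuples, Fin.sum_univ_succ]
    refine ⟨fun i => ?_, ?_⟩
    · cases i using Fin.cases
      · simpa using hx.1.1
      · simpa using hx.2.1 _
    · simp only [Fin.cons_zero, Fin.cons_succ]
      linarith [hx.2.2]

theorem sum_Icc_one_eq_sum_range (N : ℕ) (f : ℕ → ℂ) :
    ∑ k ∈ Finset.Icc 1 N, f k = ∑ k ∈ Finset.range N, f (k + 1) := by
  rw [Finset.range_eq_Ico, Finset.sum_Ico_add', ← Finset.Ico_add_one_right_eq_Icc]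

/-- The isolated summand `Q p` of `recCoeff` is the contribution of the empty tuple, and lengths
`k ≥ p` contribute nothing. -/
theorem recCoeff_eq_sum_range (Q δ : ℤ → ℂ) {p : ℤ} (hp : 1 ≤ p) {N : ℕ} (hN : p ≤ N) :
    recCoeff Q δ p = δ p * ∑ k ∈ Finset.range N, ∑ v ∈ posTuples p k, recTerm Q δ p v := by
  have h0 : ∑ v ∈ posTuples p 0, recTerm Q δ p v = Q p := by
    have : posTuples p 0 = {Fin.elim0} := by
      ext v
      simp [mem_posTuples, hp, Subsingleton.elim v Fin.elim0]
    simp [this, recTerm]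
  obtain ⟨M, rfl⟩ : ∃ M, N = M + 1 := ⟨N - 1, by omega⟩
  rw [recCoeff, Finset.sum_range_succ', h0, add_comm]
  congr 2
  rw [sum_Icc_one_eq_sum_range]
  refine (Finset.sum_subset (Finset.range_subset_range.2 (by omega)) fun k _ hk => ?_).trans rfl
  rw [Finset.mem_range] at hk
  rw [posTuples_eq_empty (by push_cast; omega), Finset.sum_empty]

/-- The closed form satisfies the recursion. -/
theorem recCoeff_eq (Q δ : ℤ → ℂ) {p : ℤ} (hp : 1 ≤ p) :
    recCoeff Q δ p =
      δ p * (Q p + ∑ m ∈ Finset.Icc 1 (p - 1), Q m * recCoeff Q δ (p - m)) := by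
  rw [recCoeff]
  congr 2
  have h : ∀ m ∈ Finset.Icc 1 (p - 1), Q m * recCoeff Q δ (p - m) =
      ∑ k ∈ Finset.range (p.natAbs - 1), ∑ w ∈ posTuples (p - m) k,
        recTerm Q δ p (Fin.cons m w : Fin (k + 1) → ℤ) := by
    intro m hm
    rw [Finset.mem_Icc] at hm
    rw [recCoeff_eq_sum_range Q δ (N := p.natAbs - 1) (by linarith) (by omega)]
    simp only [Finset.mul_sum, recTerm_cons]
  rw [Finset.sum_congr rfl h, Finset.sum_comm]
  simp only [← sum_posTuples_succ p _ (fun v => recTerm Q δ p v)]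
  exact sum_Icc_one_eq_sum_range _ _

theorem tsum_conv_eq_sum {Q Y : ℤ → ℂ} (hQ : ∀ m ≤ 0, Q m = 0) (hY : ∀ k < 0, Y k = 0) (p : ℤ) :
    ∑' k, Q (p - k) * Y k = ∑ m ∈ Finset.Icc 1 p, Q m * Y (p - m) := by
  rw [← (Equiv.subLeft p).tsum_eq]
  simp only [Equiv.subLeft_apply, sub_sub_cancel]
  refine tsum_eq_sum fun m hm => ?_
  rw [Finset.mem_Icc, not_and_or, not_le, not_le] at hm
  rcases hm with hm | hm
  · rw [hQ m (by omega), zero_mul]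
  · rw [hY _ (by omega), mul_zero]

theorem tsum_conv_eq_add_sum {Q Y : ℤ → ℂ} (hQ : ∀ m ≤ 0, Q m = 0) (hY : ∀ k < 0, Y k = 0)
    (hY0 : Y 0 = 1) {p : ℤ} (hp : 1 ≤ p) :
    ∑' k, Q (p - k) * Y k = Q p + ∑ m ∈ Finset.Icc 1 (p - 1), Q m * Y (p - m) := by
  have : Finset.Icc 1 p = insert p (Finset.Icc 1 (p - 1)) := by
    ext m; simp only [Finset.mem_Icc, Finset.mem_insert]; omega
  rw [tsum_conv_eq_sum hQ hY, this, Finset.sum_insert (by simp), sub_self, hY0, mul_one]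

/-- A summable solution of the recursion vanishes near `-∞`: its tail sum is at most one half of
itself once the tail of `δ` is small. -/
theorem exists_forall_le_eq_zero {Q δ Y : ℤ → ℂ} {B : ℝ} (hQ : ∀ m ≤ 0, Q m = 0)
    (hB : ∀ m, ‖Q m‖ ≤ B) (hδ : Summable fun p => ‖δ p‖) (hY : Summable fun p => ‖Y p‖)
    (hrec : ∀ p ≠ 0, Y p = δ p * ∑' k, Q (p - k) * Y k) :
    ∃ N : ℤ, ∀ p ≤ N, Y p = 0 := by
  have hB0 : 0 ≤ B := (norm_nonneg _).trans (hB 0)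
  obtain ⟨s, hs⟩ := ((tendsto_tsum_compl_atTop_zero fun p => ‖δ p‖).eventually
    (gt_mem_nhds (show (0 : ℝ) < 1 / (2 * (B + 1)) by positivity))).exists
  obtain ⟨b, hb⟩ := s.bddBelow
  -- Below `N` the indices avoid both the finite set `s` and the exceptional index `0`.
  set N : ℤ := min (b - 1) (-1) with hN
  set S : ℝ := ∑' k, (Iic N).indicator (fun k => ‖Y k‖) k with hS
  have hYS := hY.indicator (Iic N)
  have hS0 : 0 ≤ S := tsum_nonneg fun k => indicator_nonneg (fun _ _ => norm_nonneg _) k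
  have hδs : ∑' k, (Iic N).indicator (fun k => ‖δ k‖) k ≤ 1 / (2 * (B + 1)) := by
    refine le_trans ?_ hs.le
    have := tsum_subtype (f := fun k => ‖δ k‖) {x | x ∉ s}
    refine le_trans ?_ this.symm.le
    refine (hδ.indicator _).tsum_le_tsum (fun k => ?_) (hδ.indicator _)
    refine indicator_le_indicator_of_subset (fun k hk hks => ?_) (fun _ => norm_nonneg _) k
    have h1 := hb hks
    rw [mem_Iic] at hk
    omega
  have hbound : ∀ p ≤ N, ‖Y p‖ ≤ ‖δ p‖ * (B * S) := by
    intro p hp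
    rw [hrec p (by omega), norm_mul]
    refine mul_le_mul_of_nonneg_left ?_ (norm_nonneg _)
    refine tsum_of_norm_bounded (hYS.hasSum.mul_left B) fun k => ?_
    by_cases hk : k ≤ N
    · rw [indicator_of_mem (mem_Iic.2 hk), norm_mul]
      exact mul_le_mul_of_nonneg_right (hB _) (norm_nonneg _)
    · rw [hQ (p - k) (by omega), indicator_of_notMem (notMem_Iic.2 (not_le.1 hk))]
      simp
  have hSle : S ≤ (∑' k, (Iic N).indicator (fun k => ‖δ k‖) k) * (B * S) := by
    rw [← tsum_mul_right]
    refine hYS.tsum_le_tsum (fun k => ?_) ((hδ.indicator _).mul_right _)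
    by_cases hk : k ≤ N
    · rw [indicator_of_mem (mem_Iic.2 hk), indicator_of_mem (mem_Iic.2 hk)]
      exact hbound k hk
    · have hk' : k ∉ Iic N := notMem_Iic.2 (not_le.1 hk)
      rw [indicator_of_notMem hk', indicator_of_notMem hk', zero_mul]
  have hSzero : S = 0 := by
    have h1 : S ≤ 1 / (2 * (B + 1)) * (B * S) :=
      hSle.trans (mul_le_mul_of_nonneg_right hδs (by positivity))
    rw [div_mul_eq_mul_div, le_div_iff₀ (by positivity)] at h1
    nlinarith [mul_nonneg hB0 hS0]
  refine ⟨N, fun p hp => norm_le_zero_iff.1 ?_⟩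
  simpa [hSzero] using hbound p hp

/-- A summable solution of the recursion vanishes at all negative indices: it vanishes near `-∞`,
and below `0` each value is a combination of the preceding ones. -/
theorem eq_zero_of_neg {Q δ Y : ℤ → ℂ} {B : ℝ} (hQ : ∀ m ≤ 0, Q m = 0)
    (hB : ∀ m, ‖Q m‖ ≤ B) (hδ : Summable fun p => ‖δ p‖) (hY : Summable fun p => ‖Y p‖)
    (hrec : ∀ p ≠ 0, Y p = δ p * ∑' k, Q (p - k) * Y k) :
    ∀ p < 0, Y p = 0 := by
  obtain ⟨N, hN⟩ := exists_forall_le_eq_zero hQ hB hδ hY hrec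
  have key : ∀ j : ℕ, ∀ p ≤ N + j, p < 0 → Y p = 0 := by
    intro j
    induction j with
    | zero => exact fun p hp _ => hN p (by simpa using hp)
    | succ j ih =>
      intro p hp hp0
      have : ∀ k, Q (p - k) * Y k = 0 := fun k => by
        rcases lt_or_ge k p with hk | hk
        · rw [ih k (by push_cast at hp; omega) (by omega), mul_zero]
        · rw [hQ _ (by omega), zero_mul]
      rw [hrec _ hp0.ne, tsum_congr this, tsum_zero, mul_zero]
  exact fun p hp => key (p - N).toNat p (by omega) hp

theorem eq_recCoeff_of_pos {Q δ Y : ℤ → ℂ} (hQ : ∀ m ≤ 0, Q m = 0) (hY : ∀ k < 0, Y k = 0)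
    (hY0 : Y 0 = 1) (hrec : ∀ p ≠ 0, Y p = δ p * ∑' k, Q (p - k) * Y k) {p : ℤ} (hp : 1 ≤ p) :
    Y p = recCoeff Q δ p := by
  have key : ∀ N : ℕ, ∀ p : ℤ, 1 ≤ p → p ≤ N → Y p = recCoeff Q δ p := by
    intro N
    induction N with
    | zero => intro p h1 h2; push_cast at h2; omega
    | succ N ih =>
      intro p h1 h2
      rw [hrec p (by omega), tsum_conv_eq_add_sum hQ hY hY0 h1, recCoeff_eq Q δ h1]
      congr 2
      refine Finset.sum_congr rfl fun m hm => ?_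
      rw [Finset.mem_Icc] at hm
      rw [ih (p - m) (by omega) (by push_cast at h2; omega)]
  exact key p.toNat p hp (by omega)

/-- The solution of the recursion that is `1` at `0` and vanishes at negative indices. -/
def recSeq (Q δ : ℤ → ℂ) (p : ℤ) : ℂ :=
  if p < 0 then 0 else if p = 0 then 1 else recCoeff Q δ p

theorem recSeq_of_neg (Q δ : ℤ → ℂ) {p : ℤ} (hp : p < 0) : recSeq Q δ p = 0 := by
  simp [recSeq, hp]

theorem recSeq_zero (Q δ : ℤ → ℂ) : recSeq Q δ 0 = 1 := by simp [recSeq]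

theorem recSeq_of_pos (Q δ : ℤ → ℂ) {p : ℤ} (hp : 1 ≤ p) : recSeq Q δ p = recCoeff Q δ p := by
  rw [recSeq, if_neg (by omega), if_neg (by omega)]

/-- At `p = 0` this is the equation that the eigenvalue relation imposes without a division by
`μ_p² - μ_0²`. -/
theorem recSeq_conv_of_nonpos {Q : ℤ → ℂ} (δ : ℤ → ℂ) (hQ : ∀ m ≤ 0, Q m = 0) {p : ℤ}
    (hp : p ≤ 0) : ∑' k, Q (p - k) * recSeq Q δ k = 0 := by
  rw [tsum_conv_eq_sum hQ (fun k hk => recSeq_of_neg Q δ hk), Finset.Icc_eq_empty (by omega),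
    Finset.sum_empty]

theorem recSeq_eq {Q : ℤ → ℂ} (δ : ℤ → ℂ) (hQ : ∀ m ≤ 0, Q m = 0) {p : ℤ} (hp : p ≠ 0) :
    recSeq Q δ p = δ p * ∑' k, Q (p - k) * recSeq Q δ k := by
  rcases lt_or_gt_of_ne hp with hp | hp
  · rw [recSeq_of_neg Q δ hp, recSeq_conv_of_nonpos δ hQ hp.le, mul_zero]
  · rw [tsum_conv_eq_add_sum hQ (fun k hk => recSeq_of_neg Q δ hk) (recSeq_zero Q δ) hp,
      recSeq_of_pos Q δ hp, recCoeff_eq Q δ hp]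
    congr 2
    refine Finset.sum_congr rfl fun m hm => ?_
    rw [Finset.mem_Icc] at hm
    rw [recSeq_of_pos Q δ (by omega)]

/-- A discrete Gronwall estimate. -/
theorem sum_norm_recSeq_le {Q δ : ℤ → ℂ} {B : ℝ} (hQ : ∀ m ≤ 0, Q m = 0)
    (hB : ∀ m, ‖Q m‖ ≤ B) (N : ℕ) :
    ∑ k ∈ Finset.range (N + 1), ‖recSeq Q δ k‖ ≤
      Real.exp (B * ∑ k ∈ Finset.range (N + 1), ‖δ k‖) := by
  have hB0 : 0 ≤ B := (norm_nonneg _).trans (hB 0)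
  induction N with
  | zero =>
    simp only [zero_add, Finset.range_one, Finset.sum_singleton, Nat.cast_zero, recSeq_zero,
      norm_one]
    exact Real.one_le_exp (by positivity)
  | succ N ih =>
    have hle : ‖recSeq Q δ (N + 1 : ℕ)‖ ≤
        ‖δ (N + 1 : ℕ)‖ * (B * ∑ k ∈ Finset.range (N + 1), ‖recSeq Q δ k‖) := by
      rw [recSeq_eq δ hQ (by omega), norm_mul]
      refine mul_le_mul_of_nonneg_left ?_ (norm_nonneg _)
      rw [tsum_eq_sum (s := (Finset.range (N + 1)).map Nat.castEmbedding), Finset.sum_map,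
        Finset.mul_sum]
      · refine norm_sum_le_of_le _ fun k _ => ?_
        rw [norm_mul]
        exact mul_le_mul_of_nonneg_right (hB _) (norm_nonneg _)
      · intro k hk
        rcases lt_or_ge k 0 with h0 | h0
        · rw [recSeq_of_neg Q δ h0, mul_zero]
        · lift k to ℕ using h0
          have : ¬ k < N + 1 := fun h => hk (by
            simpa using h)
          rw [hQ _ (by push_cast; omega), zero_mul]
    rw [Finset.sum_range_succ _ (N + 1), Finset.sum_range_succ _ (N + 1), mul_add, Real.exp_add]
    set A := ∑ k ∈ Finset.range (N + 1), ‖recSeq Q δ k‖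
    calc A + ‖recSeq Q δ (N + 1 : ℕ)‖ ≤ A * (B * ‖δ (N + 1 : ℕ)‖ + 1) := by linarith
      _ ≤ _ := mul_le_mul ih (Real.add_one_le_exp _) (by positivity) (Real.exp_nonneg _)

theorem summable_norm_recSeq {Q δ : ℤ → ℂ} {B : ℝ} (hQ : ∀ m ≤ 0, Q m = 0)
    (hB : ∀ m, ‖Q m‖ ≤ B) (hδ : Summable fun p => ‖δ p‖) :
    Summable fun p => ‖recSeq Q δ p‖ := by
  have hB0 : 0 ≤ B := (norm_nonneg _).trans (hB 0)
  rw [← (Nat.cast_injective (R := ℤ)).summable_iff]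
  · refine summable_of_sum_range_le (c := Real.exp (B * ∑' k, ‖δ k‖)) (fun _ => norm_nonneg _)
      fun N => ?_
    calc ∑ k ∈ Finset.range N, ‖recSeq Q δ k‖
        ≤ ∑ k ∈ Finset.range (N + 1), ‖recSeq Q δ k‖ :=
          Finset.sum_le_sum_of_subset_of_nonneg (Finset.range_subset_range.2 N.le_succ)
            fun _ _ _ => norm_nonneg _
      _ ≤ _ := sum_norm_recSeq_le hQ hB N
      _ ≤ _ := by
          refine Real.exp_le_exp.2 (mul_le_mul_of_nonneg_left ?_ hB0)
          have := hδ.sum_le_tsum ((Finset.range (N + 1)).map Nat.castEmbedding)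
            fun _ _ => norm_nonneg _
          simpa [Finset.sum_map] using this
  · intro p hp
    rw [recSeq_of_neg Q δ, norm_zero]
    by_contra! h
    exact hp ⟨p.toNat, by omega⟩

/-! ### Absolutely continuous complex-valued functions -/

/-- A function that oscillates no more than an absolutely continuous one is absolutely continuous. -/
theorem absolutelyContinuousOnInterval_of_dist_le {X Y : Type*} [PseudoMetricSpace X]
    [PseudoMetricSpace Y] {f : ℝ → X} {g : ℝ → Y} {a b : ℝ}
    (hf : AbsolutelyContinuousOnInterval f a b)
    (h : ∀ x ∈ uIcc a b, ∀ y ∈ uIcc a b, dist (g x) (g y) ≤ dist (f x) (f y)) :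
    AbsolutelyContinuousOnInterval g a b := by
  refine squeeze_zero' (Filter.Eventually.of_forall fun _ => Finset.sum_nonneg
    fun _ _ => dist_nonneg) ?_ hf
  refine Filter.mem_inf_of_right (Filter.mem_principal.2 fun E hE => ?_)
  exact Finset.sum_le_sum fun i hi => h _ (hE.1 i hi).1 _ (hE.1 i hi).2

theorem absolutelyContinuousOnInterval_re {f : ℝ → ℂ} {a b : ℝ}
    (hf : AbsolutelyContinuousOnInterval f a b) :
    AbsolutelyContinuousOnInterval (fun x => (f x).re) a b :=
  absolutelyContinuousOnInterval_of_dist_le hf fun x _ y _ => by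
    rw [Real.dist_eq, dist_eq, ← sub_re]; exact abs_re_le_norm _

theorem absolutelyContinuousOnInterval_im {f : ℝ → ℂ} {a b : ℝ}
    (hf : AbsolutelyContinuousOnInterval f a b) :
    AbsolutelyContinuousOnInterval (fun x => (f x).im) a b :=
  absolutelyContinuousOnInterval_of_dist_le hf fun x _ y _ => by
    rw [Real.dist_eq, dist_eq, ← sub_im]; exact abs_im_le_norm _

theorem absolutelyContinuousOnInterval_of_re_im {f : ℝ → ℂ} {a b : ℝ}
    (hre : AbsolutelyContinuousOnInterval (fun x => (f x).re) a b)
    (him : AbsolutelyContinuousOnInterval (fun x => (f x).im) a b) :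
    AbsolutelyContinuousOnInterval f a b := by
  have h1 : AbsolutelyContinuousOnInterval (fun x => ((f x).re : ℂ)) a b :=
    absolutelyContinuousOnInterval_of_dist_le hre fun x _ y _ => by
      rw [Complex.dist_eq, ← ofReal_sub, norm_real, Real.dist_eq, Real.norm_eq_abs]
  have h2 : AbsolutelyContinuousOnInterval (fun x => ((f x).im : ℂ)) a b :=
    absolutelyContinuousOnInterval_of_dist_le him fun x _ y _ => by
      rw [Complex.dist_eq, ← ofReal_sub, norm_real, Real.dist_eq, Real.norm_eq_abs]
  have := h1.fun_add (h2.const_smul I)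
  have hf : (fun x => ((f x).re : ℂ) + I • ((f x).im : ℂ)) = f := by
    funext x
    rw [smul_eq_mul, mul_comm, re_add_im]
  rw [hf] at this
  exact this

theorem absolutelyContinuousOnInterval_integral {f : ℝ → ℂ} {a b : ℝ}
    (hf : IntervalIntegrable f volume a b) :
    AbsolutelyContinuousOnInterval (fun x => ∫ s in a..x, f s) a b := by
  have hx : ∀ x ∈ uIcc a b, IntervalIntegrable f volume a x := fun x hx =>
    hf.mono_set (uIcc_subset_uIcc_left hx)
  have hre : IntervalIntegrable (fun x => (f x).re) volume a b :=
    intervalIntegrable_iff.2 hf.def'.re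
  have him : IntervalIntegrable (fun x => (f x).im) volume a b :=
    intervalIntegrable_iff.2 hf.def'.im
  refine absolutelyContinuousOnInterval_of_re_im
    (absolutelyContinuousOnInterval_of_dist_le
      (hre.absolutelyContinuousOnInterval_intervalIntegral left_mem_uIcc) fun x h y h' => ?_)
    (absolutelyContinuousOnInterval_of_dist_le
      (him.absolutelyContinuousOnInterval_intervalIntegral left_mem_uIcc) fun x h y h' => ?_)
  · exact (congrArg₂ dist (reCLM.intervalIntegral_comp_comm (hx x h))
      (reCLM.intervalIntegral_comp_comm (hx y h'))).ge
  · exact (congrArg₂ dist (imCLM.intervalIntegral_comp_comm (hx x h))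
      (imCLM.intervalIntegral_comp_comm (hx y h'))).ge

theorem ae_hasDerivAt_of_absolutelyContinuous {f : ℝ → ℂ} {a b : ℝ}
    (hf : AbsolutelyContinuousOnInterval f a b) :
    ∀ᵐ x, x ∈ uIcc a b → HasDerivAt f
      (((deriv (fun x => (f x).re) x : ℝ) : ℂ) + deriv (fun x => (f x).im) x * I) x := by
  filter_upwards [(absolutelyContinuousOnInterval_re hf).ae_differentiableAt,
    (absolutelyContinuousOnInterval_im hf).ae_differentiableAt] with x h1 h2 hx
  have := (h1 hx).hasDerivAt.ofReal_comp.add ((h2 hx).hasDerivAt.ofReal_comp.mul_const I)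
  convert! this using 1
  ext x
  simp [re_add_im]

theorem intervalIntegrable_ofReal {f : ℝ → ℝ} {a b : ℝ} (hf : IntervalIntegrable f volume a b) :
    IntervalIntegrable (fun x => (f x : ℂ)) volume a b :=
  intervalIntegrable_iff.2 hf.def'.ofReal

theorem intervalIntegrable_deriv_of_absolutelyContinuous {f : ℝ → ℂ} {a b : ℝ}
    (hf : AbsolutelyContinuousOnInterval f a b) : IntervalIntegrable (deriv f) volume a b := by
  have h1 := (absolutelyContinuousOnInterval_re hf).intervalIntegrable_deriv
  have h2 := (absolutelyContinuousOnInterval_im hf).intervalIntegrable_deriv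
  have h3 : IntervalIntegrable (fun x => ((deriv (fun x => (f x).re) x : ℝ) : ℂ)
      + deriv (fun x => (f x).im) x * I) volume a b :=
    IntervalIntegrable.add (intervalIntegrable_ofReal h1)
      ((intervalIntegrable_ofReal h2).mul_const I)
  refine h3.congr_ae ?_
  rw [Filter.EventuallyEq, ae_restrict_iff' measurableSet_uIoc]
  filter_upwards [ae_hasDerivAt_of_absolutelyContinuous hf] with x hx hx'
  exact (hx (uIoc_subset_uIcc hx')).deriv.symm

theorem integral_deriv_of_absolutelyContinuous {f : ℝ → ℂ} {a b : ℝ}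
    (hf : AbsolutelyContinuousOnInterval f a b) : ∫ x in a..b, deriv f x = f b - f a := by
  have h1 := absolutelyContinuousOnInterval_re hf
  have h2 := absolutelyContinuousOnInterval_im hf
  have h3 : ∫ x in a..b, deriv f x = ∫ x in a..b, (((deriv (fun x => (f x).re) x : ℝ) : ℂ)
      + deriv (fun x => (f x).im) x * I) := by
    refine intervalIntegral.integral_congr_ae ?_
    filter_upwards [ae_hasDerivAt_of_absolutelyContinuous hf] with x hx hx'
    exact (hx (uIoc_subset_uIcc hx')).deriv
  rw [h3, intervalIntegral.integral_add
      (intervalIntegrable_ofReal h1.intervalIntegrable_deriv)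
      ((intervalIntegrable_ofReal h2.intervalIntegrable_deriv).mul_const I),
    intervalIntegral.integral_mul_const, intervalIntegral.integral_ofReal,
    intervalIntegral.integral_ofReal, h1.integral_deriv_eq_sub, h2.integral_deriv_eq_sub]
  apply Complex.ext <;> simp

theorem D_eq_deriv {y : ℝ → ℂ} {x : ℝ} (hx : x ∈ Ioo (0 : ℝ) 1) : D y x = deriv y x :=
  derivWithin_of_mem_nhds (Icc_mem_nhds hx.1 hx.2)

theorem ae_mem_Ioo : ∀ᵐ x ∂volume.restrict (Icc (0 : ℝ) 1), x ∈ Ioo (0 : ℝ) 1 := by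
  rw [← restrict_Ioo_eq_restrict_Icc]
  exact ae_restrict_mem measurableSet_Ioo

theorem expo_hasDerivAt (μ : ℂ) (x : ℝ) : HasDerivAt (expo μ) (I * μ * expo μ x) x := by
  have h : HasDerivAt (fun x : ℝ => I * μ * (x : ℂ)) (I * μ) x := by
    simpa using (hasDerivAt_id x).ofReal_comp.const_mul (I * μ)
  rw [mul_comm]
  exact h.cexp

/-- The Fourier coefficient `∫₀¹ y(x) e^{-iμx} dx` at a complex frequency `μ`. In terms of
`pairing` it is `(y, e^{i conj(μ) x})`. -/
def coef (y : ℝ → ℂ) (μ : ℂ) : ℂ := ∫ x in (0 : ℝ)..1, y x * expo (-μ) x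

theorem intervalIntegrable_D_D {y : ℝ → ℂ} (hac : AbsolutelyContinuousOnInterval (D y) 0 1) :
    IntervalIntegrable (D (D y)) volume 0 1 := by
  refine (intervalIntegrable_deriv_of_absolutelyContinuous hac).congr_ae ?_
  rw [uIoc_of_le zero_le_one, restrict_Ioc_eq_restrict_Icc]
  filter_upwards [ae_mem_Ioo] with x hx using (D_eq_deriv hx).symm

/-- Integration by parts twice; quasi-periodicity makes the boundary terms cancel. -/
theorem coef_D_D {y : ℝ → ℂ} {t μ : ℂ} (hd : DifferentiableOn ℝ y (Icc 0 1))
    (hac : AbsolutelyContinuousOnInterval (D y) 0 1) (hb : y 1 = exp (I * t) * y 0)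
    (hb' : D y 1 = exp (I * t) * D y 0) (hμ : exp (I * μ) = exp (I * t)) :
    coef (D (D y)) μ = -μ ^ 2 * coef y μ := by
  have hDc : ContinuousOn (D y) (Icc 0 1) := by
    simpa [uIcc_of_le zero_le_one] using hac.continuousOn
  have hyac : AbsolutelyContinuousOnInterval y 0 1 := by
    refine ContDiffOn.absolutelyContinuousOnInterval ?_
    rw [uIcc_of_le zero_le_one, contDiffOn_one_iff_derivWithin (uniqueDiffOn_Icc zero_lt_one)]
    exact ⟨hd, hDc⟩
  have heac : AbsolutelyContinuousOnInterval (expo (-μ)) 0 1 := by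
    refine ContDiffOn.absolutelyContinuousOnInterval (ContDiff.contDiffOn ?_)
    unfold expo
    exact (contDiff_const.mul ofRealCLM.contDiff).cexp
  have hec : Continuous (expo (-μ)) := by unfold expo; fun_prop
  -- The derivative of `(y' + iμy) e^{-iμx}` is `(y'' + μ² y) e^{-iμx}`.
  have hhac : AbsolutelyContinuousOnInterval
      (fun x => (D y x + (I * μ) • y x) • expo (-μ) x) 0 1 :=
    (hac.fun_add (hyac.const_smul (I * μ))).fun_smul heac
  have hint := integral_deriv_of_absolutelyContinuous hhac
  have hderiv : ∫ x in (0 : ℝ)..1, deriv (fun x => (D y x + (I * μ) • y x) • expo (-μ) x) x =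
      ∫ x in (0 : ℝ)..1, (D (D y) x * expo (-μ) x + μ ^ 2 * (y x * expo (-μ) x)) := by
    refine intervalIntegral.integral_congr_ae ?_
    rw [← ae_restrict_iff' measurableSet_uIoc, uIoc_of_le zero_le_one,
      restrict_Ioc_eq_restrict_Icc]
    filter_upwards [ae_mem_Ioo,
      ae_restrict_of_ae (ae_hasDerivAt_of_absolutelyContinuous hac)] with x hx h
    have h1 := h (by rw [uIcc_of_le zero_le_one]; exact Ioo_subset_Icc_self hx)
    rw [← h1.deriv, ← D_eq_deriv hx] at h1
    have h2 : HasDerivAt y (D y x) x := by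
      rw [D_eq_deriv hx]
      exact ((hd x (Ioo_subset_Icc_self hx)).differentiableAt (Icc_mem_nhds hx.1 hx.2)).hasDerivAt
    have h3 := (h1.add (h2.const_smul (I * μ))).smul (expo_hasDerivAt (-μ) x)
    refine (h3.deriv).trans ?_
    simp only [smul_eq_mul, Pi.add_apply, Pi.smul_apply]
    linear_combination (μ ^ 2 * y x * expo (-μ) x) * (-I_sq)
  have hi1 : IntervalIntegrable (fun x => D (D y) x * expo (-μ) x) volume 0 1 :=
    (intervalIntegrable_D_D hac).mul_continuousOn hec.continuousOn
  have hi2 : IntervalIntegrable (fun x => y x * expo (-μ) x) volume 0 1 :=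
    (hyac.continuousOn.mul hec.continuousOn).intervalIntegrable
  rw [hderiv, intervalIntegral.integral_add hi1 (hi2.const_mul _),
    intervalIntegral.integral_const_mul] at hint
  have he : expo (-μ) 1 * exp (I * t) = 1 := by
    rw [← hμ, expo, ← Complex.exp_add]; simp
  have he0 : expo (-μ) 0 = 1 := by simp [expo]
  rw [coef, coef, eq_sub_of_add_eq hint, hb, hb', he0]
  simp only [smul_eq_mul]
  linear_combination (D y 0 + I * μ * y 0) * he

/-! ### Exponentials, frequencies and Fourier series -/

theorem expo_mul_expo (μ ν : ℂ) (x : ℝ) : expo μ x * expo ν x = expo (μ + ν) x := by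
  simp only [expo, ← Complex.exp_add]
  ring_nf

theorem conj_expo (μ : ℂ) (x : ℝ) : conj (expo μ x) = expo (-conj μ) x := by
  simp [expo, ← exp_conj]

theorem norm_expo (μ : ℂ) (x : ℝ) : ‖expo μ x‖ = Real.exp (-(μ.im * x)) := by
  simp [expo, norm_exp]

theorem continuous_expo (μ : ℂ) : Continuous (expo μ) := by unfold expo; fun_prop

theorem expo_zero_right (μ : ℂ) : expo μ 0 = 1 := by simp [expo]

theorem pairing_expo (f : ℝ → ℂ) (μ : ℂ) : pairing f (expo μ) = coef f (conj μ) := by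
  simp only [pairing, coef, conj_expo]

theorem qCoeff_eq_coef (q : ℝ → ℂ) (m : ℤ) : qCoeff q m = coef q (2 * Real.pi * m) := by
  rw [qCoeff, pairing_expo, map_mul, map_mul, map_ofNat, conj_ofReal, map_intCast]

theorem norm_coef_le {f : ℝ → ℂ} (hf : IntervalIntegrable f volume 0 1) (μ : ℂ) :
    ‖coef f μ‖ ≤ Real.exp |μ.im| * ∫ x in (0 : ℝ)..1, ‖f x‖ := by
  rw [← intervalIntegral.integral_const_mul]
  refine intervalIntegral.norm_integral_le_of_norm_le zero_le_one
    (.of_forall fun x hx => ?_) (hf.norm.const_mul _)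
  rw [norm_mul, norm_expo, mul_comm]
  refine mul_le_mul_of_nonneg_right (Real.exp_le_exp.2 ?_) (norm_nonneg _)
  rw [neg_im, neg_mul, neg_neg]
  exact (mul_le_mul_of_nonneg_right (le_abs_self _) hx.1.le).trans
    (mul_le_of_le_one_right (abs_nonneg _) hx.2)

/-- The frequencies `2π(n + p) + t`, `p ∈ ℤ`, of the exponentials satisfying the quasi-periodic
boundary conditions, numbered so that the eigenvalue `(2πn + t)²` belongs to `p = 0`. -/
def freq (n : ℤ) (t : ℂ) (p : ℤ) : ℂ := 2 * Real.pi * (n + (p : ℂ)) + t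

theorem freq_zero (n : ℤ) (t : ℂ) : freq n t 0 = 2 * Real.pi * n + t := by simp [freq]

theorem freq_sub_freq (n : ℤ) (t : ℂ) (p k : ℤ) :
    freq n t p - freq n t k = 2 * Real.pi * (p - k : ℤ) := by
  simp only [freq]; push_cast; ring

theorem freq_im (n : ℤ) (t : ℂ) (p : ℤ) : (freq n t p).im = t.im := by
  simp [freq]

theorem exp_I_mul_freq (n : ℤ) (t : ℂ) (p : ℤ) : exp (I * freq n t p) = exp (I * t) := by
  rw [exp_eq_exp_iff_exists_int]
  exact ⟨n + p, by simp only [freq]; push_cast; ring⟩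

theorem freq_ne_zero {t : ℂ} (ht : ∀ k : ℤ, t ≠ Real.pi * k) (n p : ℤ) : freq n t p ≠ 0 := by
  intro h
  refine ht (-2 * (n + p)) ?_
  rw [freq] at h
  push_cast
  linear_combination h

theorem d_eq (n p : ℤ) (t : ℂ) : d p n t = -(freq n t p ^ 2 - freq n t 0 ^ 2)⁻¹ := by
  rw [d]
  congr 2
  simp only [freq]; push_cast; ring

theorem freq_sq_sub_ne_zero {t : ℂ} (ht : ∀ k : ℤ, t ≠ Real.pi * k) (n : ℤ) {p : ℤ} (hp : p ≠ 0) :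
    freq n t p ^ 2 - freq n t 0 ^ 2 ≠ 0 := by
  have hpi : (Real.pi : ℂ) ≠ 0 := ofReal_ne_zero.2 Real.pi_ne_zero
  have hp' : (p : ℂ) ≠ 0 := Int.cast_ne_zero.2 hp
  have : freq n t p ^ 2 - freq n t 0 ^ 2 =
      4 * (Real.pi * p) * (t - Real.pi * (-(2 * n + p) : ℤ)) := by
    simp only [freq]; push_cast; ring
  rw [this]
  exact mul_ne_zero (mul_ne_zero (by norm_num) (mul_ne_zero hpi hp')) (sub_ne_zero.2 (ht _))

theorem summable_norm_inv_linear_mul_linear (w w' : ℂ) :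
    Summable fun k : ℤ => ‖((2 * Real.pi * k + w) * (2 * Real.pi * k + w'))⁻¹‖ := by
  have hpi : (Real.pi : ℂ) ≠ 0 := ofReal_ne_zero.2 Real.pi_ne_zero
  have h : Summable fun k : ℤ =>
      ((w / (2 * Real.pi) + k) * (w' / (2 * Real.pi) + k))⁻¹ := by
    apply EisensteinSeries.summable_inv_of_isBigO_rpow_inv (a := 2) (by norm_cast)
    simpa [pow_two] using
      (EisensteinSeries.linear_inv_isBigO_right 1 (w' / (2 * Real.pi))).mul
        (EisensteinSeries.linear_inv_isBigO_right 1 (w / (2 * Real.pi)))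
  refine ((h.mul_left ((2 * Real.pi : ℂ) ^ 2)⁻¹).norm).congr fun k => ?_
  rw [← mul_inv]
  congr 2
  field_simp
  ring

theorem summable_norm_inv_freq_sq (n : ℤ) (t : ℂ) : Summable fun p => ‖(freq n t p ^ 2)⁻¹‖ := by
  refine (summable_norm_inv_linear_mul_linear (2 * Real.pi * n + t) (2 * Real.pi * n + t)).congr
    fun p => ?_
  congr 2
  simp only [freq]; ring

theorem summable_norm_d (n : ℤ) (t : ℂ) : Summable fun p => ‖d p n t‖ := by
  refine (summable_norm_inv_linear_mul_linear 0 (4 * Real.pi * n + 2 * t)).congr fun p => ?_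
  rw [d, norm_neg]
  congr 2
  ring

/-- A continuous quasi-periodic function with summable coefficients is the sum of its Fourier
series, at both end points too: multiplied by `e^{-i(2πn + t)x}` it descends to the circle. -/
theorem hasSum_coef_mul_expo {y : ℝ → ℂ} {n : ℤ} {t : ℂ} (hc : ContinuousOn y (Icc 0 1))
    (hb : y 1 = exp (I * t) * y 0) (hs : Summable fun p => coef y (freq n t p)) {x : ℝ}
    (hx : x ∈ Icc (0 : ℝ) 1) :
    HasSum (fun p => coef y (freq n t p) * expo (freq n t p) x) (y x) := by
  set F : ℝ → ℂ := fun x => y x * expo (-freq n t 0) x with hF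
  have hF01 : F 0 = F 1 := by
    have : exp (I * freq n t 0) * expo (-freq n t 0) 1 = 1 := by
      rw [expo, ← Complex.exp_add]; simp
    rw [exp_I_mul_freq] at this
    simp only [hF, hb, expo_zero_right]
    linear_combination -y 0 * this
  set G : C(AddCircle (1 : ℝ), ℂ) := ⟨AddCircle.liftIco 1 0 F,
    AddCircle.liftIco_zero_continuous hF01 (hc.mul (continuous_expo _).continuousOn)⟩ with hG
  have hGF : ∀ x ∈ Icc (0 : ℝ) 1, G (x : AddCircle (1 : ℝ)) = F x := by
    intro x hx
    rcases hx.2.lt_or_eq with h | rfl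
    · exact AddCircle.liftIco_zero_coe_apply (f := F) ⟨hx.1, h⟩
    · have h0 : G ((0 : ℝ) : AddCircle (1 : ℝ)) = F 0 :=
        AddCircle.liftIco_zero_coe_apply (f := F) ⟨le_rfl, one_pos⟩
      rw [← hF01, ← h0]
      congr 1
      rw [AddCircle.coe_period]; rfl
  have hfour : ∀ (m : ℤ) (x : ℝ), fourier m (x : AddCircle (1 : ℝ)) = expo (2 * Real.pi * m) x := by
    intro m x
    rw [fourier_coe_apply, expo]
    congr 1
    push_cast; ring
  have hcoef : ∀ p, fourierCoeff G p = coef y (freq n t p) := by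
    intro p
    rw [fourierCoeff_eq_intervalIntegral _ _ 0]
    simp only [zero_add, div_one, one_smul, coef]
    refine intervalIntegral.integral_congr fun x hx => ?_
    rw [uIcc_of_le zero_le_one] at hx
    simp only [hGF x hx, hfour, hF, smul_eq_mul]
    rw [mul_comm, mul_assoc, expo_mul_expo]
    congr 2
    simp only [freq]; push_cast; ring
  have hsum := has_pointwise_sum_fourier_series_of_summable
    (f := G) (hs.congr fun p => (hcoef p).symm) (x : AddCircle (1 : ℝ))
  have := hsum.mul_right (expo (freq n t 0) x)
  rw [hGF x hx, hF] at this
  simp only [mul_assoc, expo_mul_expo] at this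
  convert! this using 1
  · funext p
    rw [hcoef, hfour, smul_eq_mul, mul_assoc, expo_mul_expo]
    congr 2
    simp only [freq]; push_cast; ring
  · rw [neg_add_cancel, expo]
    simp

/-- The coefficients of a product are the convolution of the coefficients. -/
theorem hasSum_coef_mul {q y : ℝ → ℂ} {n : ℤ} {t : ℂ} {Y : ℤ → ℂ}
    (hq : IntervalIntegrable q volume 0 1) (hY : Summable fun k => ‖Y k‖)
    (hy : ∀ x ∈ Icc (0 : ℝ) 1, HasSum (fun k => Y k * expo (freq n t k) x) (y x)) (p : ℤ) :
    HasSum (fun k => qCoeff q (p - k) * Y k) (coef (fun x => q x * y x) (freq n t p)) := by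
  have hterm : ∀ (k : ℤ) (x : ℝ), q x * expo (-(2 * Real.pi * (p - k : ℤ))) x * Y k =
      q x * (Y k * expo (freq n t k) x) * expo (-freq n t p) x := by
    intro k x
    rw [← freq_sub_freq n t p k, neg_sub, sub_eq_add_neg, ← expo_mul_expo]
    ring
  have hnorm : ∀ (k : ℤ) (x : ℝ), ‖expo (-(2 * Real.pi * (p - k : ℤ))) x‖ = 1 := by
    intro k x
    rw [norm_expo]; simp
  have hiff : ∀ x, x ∈ uIoc (0 : ℝ) 1 → x ∈ Icc (0 : ℝ) 1 := fun x hx => by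
    rw [uIoc_of_le zero_le_one] at hx; exact Ioc_subset_Icc_self hx
  have := intervalIntegral.hasSum_integral_of_dominated_convergence (μ := volume)
    (a := 0) (b := 1)
    (F := fun (k : ℤ) x => q x * expo (-(2 * Real.pi * (p - k : ℤ))) x * Y k)
    (f := fun x => q x * y x * expo (-freq n t p) x)
    (fun k x => ‖q x‖ * ‖Y k‖)
    (fun k => ((hq.def'.aestronglyMeasurable.mul
      (continuous_expo _).aestronglyMeasurable).mul_const _))
    (fun k => .of_forall fun x _ => by rw [norm_mul, norm_mul, hnorm, mul_one])
    (.of_forall fun x _ => hY.mul_left _)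
    (by simpa only [tsum_mul_left] using hq.norm.mul_const _)
    (.of_forall fun x hx => by
      simp only [hterm]
      exact ((hy x (hiff x hx)).mul_left _).mul_right _)
  simpa only [intervalIntegral.integral_mul_const, qCoeff_eq_coef, coef] using this

theorem qCoeff_one (m : ℤ) : qCoeff (fun _ => 1) m = if m = 0 then 1 else 0 := by
  rw [qCoeff_eq_coef, coef]
  split_ifs with h
  · simp [h, expo]
  · have hc : I * -(2 * Real.pi * m) ≠ 0 := by
      simp [Real.pi_ne_zero, h]
    simp only [expo, one_mul]
    rw [integral_exp_mul_complex hc]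
    have : I * -(2 * Real.pi * m) * ((1 : ℝ) : ℂ) = (-m : ℤ) * (2 * Real.pi * I) := by
      push_cast; ring
    rw [this, exp_int_mul_two_pi_mul_I]
    simp

/-- An absolutely convergent series of exponentials has its own coefficients as Fourier
coefficients. -/
theorem coef_of_hasSum {y : ℝ → ℂ} {n : ℤ} {t : ℂ} {Y : ℤ → ℂ} (hY : Summable fun k => ‖Y k‖)
    (hy : ∀ x ∈ Icc (0 : ℝ) 1, HasSum (fun k => Y k * expo (freq n t k) x) (y x)) (p : ℤ) :
    coef y (freq n t p) = Y p := by
  have := hasSum_coef_mul (q := fun _ => 1) (by simp) hY hy p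
  simp only [one_mul, qCoeff_one, sub_eq_zero] at this
  refine this.unique ?_
  convert! hasSum_ite_eq p (Y p) using 2 with k
  by_cases h : p = k <;> simp [h, eq_comm]

/-! ### Eigenfunctions -/

/-- The problem `z'' = f` with quasi-periodic boundary conditions is solvable when `e^{it} ≠ 1`. -/
theorem exists_quasiperiodic_primitive {f : ℝ → ℂ} {t : ℂ} (hf : IntervalIntegrable f volume 0 1)
    (ht : exp (I * t) ≠ 1) :
    ∃ z : ℝ → ℂ, DifferentiableOn ℝ z (Icc 0 1) ∧ AbsolutelyContinuousOnInterval (D z) 0 1 ∧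
      z 1 = exp (I * t) * z 0 ∧ D z 1 = exp (I * t) * D z 0 ∧
      ∀ᵐ x ∂volume.restrict (Icc (0 : ℝ) 1), D (D z) x = f x := by
  have ht' : exp (I * t) - 1 ≠ 0 := sub_ne_zero.2 ht
  -- Extending `f` by zero makes its primitive continuous on the whole line.
  set g : ℝ → ℂ := (uIoc 0 1).indicator f with hg
  have hgi : Integrable g volume := (integrable_indicator_iff measurableSet_uIoc).2 hf.def'
  have hgf : ∀ᵐ x ∂volume.restrict (Icc (0 : ℝ) 1), g x = f x := by
    filter_upwards [ae_mem_Ioo] with x hx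
    rw [hg, indicator_of_mem]
    rw [uIoc_of_le zero_le_one]
    exact Ioo_subset_Ioc_self hx
  -- The constants `α`, `β` of integration are forced by the boundary conditions for `z'` and `z`.
  set α : ℂ := (∫ s in (0 : ℝ)..1, g s) / (exp (I * t) - 1) with hα
  set G : ℝ → ℂ := fun x => (∫ s in (0 : ℝ)..x, g s) + α with hG
  have hGc : Continuous G :=
    (intervalIntegral.continuous_primitive (fun _ _ => hgi.intervalIntegrable) 0).add_const α
  set β : ℂ := (∫ s in (0 : ℝ)..1, G s) / (exp (I * t) - 1) with hβ
  set z : ℝ → ℂ := fun x => (∫ s in (0 : ℝ)..x, G s) + β with hz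
  have hz' : ∀ x, HasDerivAt z (G x) x := fun x =>
    (intervalIntegral.integral_hasDerivAt_right (hGc.intervalIntegrable _ _)
      (hGc.stronglyMeasurableAtFilter _ _) hGc.continuousAt).add_const β
  have hDz : EqOn (D z) G (Icc 0 1) := fun x hx =>
    (hz' x).hasDerivWithinAt.derivWithin (uniqueDiffOn_Icc zero_lt_one x hx)
  have hGac : AbsolutelyContinuousOnInterval (fun x => ∫ s in (0 : ℝ)..x, g s) 0 1 :=
    absolutelyContinuousOnInterval_integral hgi.intervalIntegrable
  refine ⟨z, fun x _ => (hz' x).differentiableAt.differentiableWithinAt,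
    absolutelyContinuousOnInterval_of_dist_le hGac fun x hx y hy => ?_, ?_, ?_, ?_⟩
  · rw [uIcc_of_le zero_le_one] at hx hy
    rw [hDz hx, hDz hy, hG]
    simp
  · simp only [hz, intervalIntegral.integral_same, zero_add]
    rw [hβ]
    field_simp
    ring
  · rw [hDz (right_mem_Icc.2 zero_le_one), hDz (left_mem_Icc.2 zero_le_one)]
    simp only [hG, intervalIntegral.integral_same, zero_add]
    rw [hα]
    field_simp
    ring
  · filter_upwards [ae_mem_Ioo, hgf, ae_restrict_of_ae
      (hgi.intervalIntegrable (a := 0) (b := 1)).ae_hasDerivAt_integral] with x hx hgx h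
    have hx' : x ∈ Icc (0 : ℝ) 1 := Ioo_subset_Icc_self hx
    have h1 := (h (by rwa [uIcc_of_le zero_le_one]) 0 left_mem_uIcc).add_const α
    rw [← hgx, D, derivWithin_congr hDz (hDz hx')]
    exact h1.hasDerivWithinAt.derivWithin (uniqueDiffOn_Icc zero_lt_one x hx')

theorem InDomain.continuousOn {q y : ℝ → ℂ} {t : ℂ} (hy : InDomain q t y) :
    ContinuousOn y (Icc 0 1) := hy.differentiableOn.continuousOn

theorem coef_eq_sub_of_ae_eq {q u f : ℝ → ℂ} {lam μ : ℂ} (hq : IntervalIntegrable q volume 0 1)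
    (hu : ContinuousOn u (uIcc 0 1))
    (h : ∀ᵐ x ∂volume.restrict (Icc (0 : ℝ) 1), f x = q x * u x - lam * u x) :
    coef f μ = coef (fun x => q x * u x) μ - lam * coef u μ := by
  have hec : ContinuousOn (expo (-μ)) (uIcc 0 1) := (continuous_expo _).continuousOn
  have hi : IntervalIntegrable (fun x => u x * expo (-μ) x) volume 0 1 :=
    (hu.mul hec).intervalIntegrable
  simp only [coef]
  rw [← intervalIntegral.integral_const_mul, ← intervalIntegral.integral_sub
    ((hq.mul_continuousOn hu).mul_continuousOn hec) (hi.const_mul lam)]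
  refine intervalIntegral.integral_congr_ae ?_
  rw [← ae_restrict_iff' measurableSet_uIoc, uIoc_of_le zero_le_one,
    restrict_Ioc_eq_restrict_Icc]
  filter_upwards [h] with x hx
  rw [hx]
  ring

/-- The eigenvalue equation in terms of Fourier coefficients. -/
theorem IsEigenfunction.coef_eq {q y : ℝ → ℂ} {t lam : ℂ} (hy : IsEigenfunction q t lam y)
    (hq : IntervalIntegrable q volume 0 1) (n p : ℤ) :
    (freq n t p ^ 2 - lam) * coef y (freq n t p) =
      -coef (fun x => q x * y x) (freq n t p) := by
  have hD := coef_D_D hy.inDomain.differentiableOn hy.inDomain.absolutelyContinuous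
    hy.inDomain.boundary hy.inDomain.boundary_deriv (exp_I_mul_freq n t p)
  have hyc : ContinuousOn y (uIcc 0 1) := by
    rw [uIcc_of_le zero_le_one]; exact hy.inDomain.continuousOn
  have h := coef_eq_sub_of_ae_eq hq hyc (f := D (D y)) (lam := lam) (μ := freq n t p) (by
    filter_upwards [hy.eq] with x hx
    rw [expr] at hx
    linear_combination -hx)
  linear_combination hD - h

theorem InDomain.summable_norm_coef {q y : ℝ → ℂ} {t : ℂ} (hy : InDomain q t y)
    (ht : ∀ k : ℤ, t ≠ Real.pi * k) (n : ℤ) :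
    Summable fun p => ‖coef y (freq n t p)‖ := by
  refine Summable.of_nonneg_of_le (fun _ => norm_nonneg _) (fun p => ?_)
    ((summable_norm_inv_freq_sq n t).mul_right
      (Real.exp |t.im| * ∫ x in (0 : ℝ)..1, ‖D (D y) x‖))
  have hD := coef_D_D hy.differentiableOn hy.absolutelyContinuous
    hy.boundary hy.boundary_deriv (exp_I_mul_freq n t p)
  have h0 : freq n t p ^ 2 ≠ 0 := pow_ne_zero 2 (freq_ne_zero ht n p)
  have : coef y (freq n t p) = (freq n t p ^ 2)⁻¹ * -coef (D (D y)) (freq n t p) := by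
    rw [hD, neg_mul, neg_neg, inv_mul_cancel_left₀ h0]
  rw [this, norm_mul, norm_neg]
  refine mul_le_mul_of_nonneg_left ?_ (norm_nonneg _)
  simpa only [freq_im] using norm_coef_le (intervalIntegrable_D_D hy.absolutelyContinuous)
    (freq n t p)

/-- Any nonzero summable solution of the eigenvalue equation for Fourier coefficients comes from an
eigenfunction. -/
theorem exists_isEigenfunction {q : ℝ → ℂ} {t lam : ℂ} {n : ℤ} {Y : ℤ → ℂ}
    (hq : IntervalIntegrable q volume 0 1) (ht : ∀ k : ℤ, t ≠ Real.pi * k)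
    (hY : Summable fun k => ‖Y k‖) (hY0 : ∃ k, Y k ≠ 0)
    (h : ∀ p, (freq n t p ^ 2 - lam) * Y p = -∑' k, qCoeff q (p - k) * Y k) :
    ∃ y, IsEigenfunction q t lam y ∧ ∀ p, coef y (freq n t p) = Y p := by
  have hbound : ∀ k, ∀ x ∈ Icc (0 : ℝ) 1, ‖Y k * expo (freq n t k) x‖ ≤
      ‖Y k‖ * Real.exp |t.im| := by
    intro k x hx
    rw [norm_mul, norm_expo, freq_im]
    refine mul_le_mul_of_nonneg_left (Real.exp_le_exp.2 ?_) (norm_nonneg _)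
    rw [← neg_mul]
    exact (mul_le_mul_of_nonneg_right (neg_le_abs _) hx.1).trans
      (mul_le_of_le_one_right (abs_nonneg _) hx.2)
  set u : ℝ → ℂ := fun x => ∑' k, Y k * expo (freq n t k) x with hu
  have huc : ContinuousOn u (uIcc 0 1) := by
    rw [uIcc_of_le zero_le_one]
    exact continuousOn_tsum (fun k => ((continuous_expo _).const_mul _).continuousOn)
      (hY.mul_right _) hbound
  have hus : ∀ x ∈ Icc (0 : ℝ) 1, HasSum (fun k => Y k * expo (freq n t k) x) (u x) :=
    fun x hx => (Summable.of_norm_bounded (hY.mul_right _) fun k => hbound k x hx).hasSum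
  have hucoef := coef_of_hasSum hY hus
  have hqu : IntervalIntegrable (fun x => q x * u x) volume 0 1 := hq.mul_continuousOn huc
  have hlu : IntervalIntegrable (fun x => lam * u x) volume 0 1 :=
    huc.intervalIntegrable.const_mul lam
  have ht1 : exp (I * t) ≠ 1 := by
    rw [Ne, exp_eq_one_iff]
    rintro ⟨k, hk⟩
    refine ht (2 * k) (mul_left_cancel₀ I_ne_zero ?_)
    rw [hk]; push_cast; ring
  obtain ⟨z, hd, hac, hb, hb', hDD⟩ := exists_quasiperiodic_primitive (hqu.sub hlu) ht1
  have hzcoef : ∀ p, coef z (freq n t p) = Y p := by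
    intro p
    have h1 := coef_D_D hd hac hb hb' (exp_I_mul_freq n t p)
    have h2 := coef_eq_sub_of_ae_eq (μ := freq n t p) hq huc hDD
    have h3 := h p
    rw [(hasSum_coef_mul hq hY hus p).tsum_eq] at h3
    rw [hucoef] at h2
    refine mul_left_cancel₀ (pow_ne_zero 2 (freq_ne_zero ht n p)) ?_
    linear_combination h1 - h2 - h3
  have hzu : ∀ x ∈ Icc (0 : ℝ) 1, z x = u x := by
    intro x hx
    have hs : Summable fun p => coef z (freq n t p) := by
      simpa only [hzcoef] using hY.of_norm
    have := hasSum_coef_mul_expo hd.continuousOn hb hs hx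
    simp only [hzcoef] at this
    exact this.unique (hus x hx)
  have heq : ∀ᵐ x ∂(volume.restrict (Icc (0 : ℝ) 1)), expr q z x = lam * z x := by
    filter_upwards [hDD, ae_restrict_mem measurableSet_Icc] with x hx hx'
    rw [expr, hx, hzu x hx']
    ring
  have hmem : MemLp (expr q z) 2 (volume.restrict (Icc 0 1)) := by
    have hc : ContinuousOn (fun x => lam * z x) (Icc 0 1) := continuousOn_const.mul hd.continuousOn
    obtain ⟨C, hC⟩ := isCompact_Icc.exists_bound_of_continuousOn hc
    refine (MemLp.of_bound (hc.aestronglyMeasurable measurableSet_Icc) C ?_).ae_eq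
      (Filter.EventuallyEq.symm heq)
    filter_upwards [ae_restrict_mem measurableSet_Icc] with x hx using hC x hx
  refine ⟨z, ⟨⟨hd, hac, hmem, hb, hb'⟩, heq, ?_⟩, hzcoef⟩
  by_contra! hz0
  obtain ⟨k, hk⟩ := hY0
  refine hk ?_
  rw [← hzcoef k, coef]
  refine intervalIntegral.integral_zero_ae (.of_forall fun x hx => ?_)
  rw [uIoc_of_le zero_le_one] at hx
  rw [hz0 x (Ioc_subset_Icc_self hx), zero_mul]

/-- Both cases of the theorem at once: `e` is the identity for `L₁⁺` and the reflection `p ↦ -p` for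
`L₁⁻`. -/
theorem exists_normalizedEigenfunction_and_hasSum {q : ℝ → ℂ} {t : ℂ}
    (ht : ∀ k : ℤ, t ≠ Real.pi * k) (n : ℤ) (e : ℤ ≃+ ℤ) (hq : IntegrableOn q (Icc 0 1) volume)
    (hQ : ∀ m ≤ 0, qCoeff q (e m) = 0) :
    (∃ Ψ : ℝ → ℂ, IsNormalizedEigenfunction q t n Ψ) ∧
      ∀ Ψ : ℝ → ℂ, IsNormalizedEigenfunction q t n Ψ → ∀ x ∈ Icc (0 : ℝ) 1,
        HasSum (fun p : ℕ+ =>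
            recCoeff (fun m => qCoeff q (e m)) (fun p => d (e p) n t) p *
              expo (freq n t (e p)) x)
          (Ψ x - expo (2 * Real.pi * n + t) x) := by
  have hqi : IntervalIntegrable q volume 0 1 :=
    (intervalIntegrable_iff_integrableOn_Icc_of_le zero_le_one).2 hq
  have hB : ∀ m, ‖qCoeff q (e m)‖ ≤ ∫ x in (0 : ℝ)..1, ‖q x‖ := fun m => by
    simpa [qCoeff_eq_coef] using norm_coef_le hqi (2 * Real.pi * (e m))
  have hδ : Summable fun p => ‖d (e p) n t‖ :=
    (e.toEquiv.summable_iff (f := fun p => ‖d p n t‖)).2 (summable_norm_d n t)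
  have hnorm : ∀ Ψ : ℝ → ℂ,
      pairing Ψ (expo (2 * Real.pi * n + conj t)) = coef Ψ (freq n t 0) := fun Ψ => by
    
    rw [pairing_expo, freq_zero, map_add, map_mul, map_mul, map_ofNat, conj_ofReal, map_intCast,
      conj_conj]
  have hconv : ∀ (Z : ℤ → ℂ) (p : ℤ), ∑' k, qCoeff q (e (p - k)) * Z (e k) =
      ∑' k, qCoeff q (e p - k) * Z k := fun Z p => by
    simp only [map_sub]
    exact e.toEquiv.tsum_eq fun k => qCoeff q (e p - k) * Z k
  have he0 : ∀ {p : ℤ}, p ≠ 0 → e p ≠ 0 := fun hp => (map_ne_zero_iff e e.injective).2 hp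
  constructor
  · set R := recSeq (fun m => qCoeff q (e m)) (fun p => d (e p) n t) with hR
    have hRs : Summable fun p => ‖R (e.symm p)‖ :=
      (e.symm.toEquiv.summable_iff (f := fun p => ‖R p‖)).2 (summable_norm_recSeq hQ hB hδ)
    have hR0 : R (e.symm 0) = 1 := by rw [map_zero]; exact recSeq_zero _ _
    obtain ⟨Ψ, h1, h2⟩ := exists_isEigenfunction (lam := freq n t 0 ^ 2) hqi ht hRs
      ⟨0, by rw [hR0]; exact one_ne_zero⟩ fun p => by
        obtain ⟨p, rfl⟩ := e.surjective p
        rw [← hconv (fun k => R (e.symm k)) p]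
        simp only [AddEquiv.symm_apply_apply]
        by_cases hp : p = 0
        · subst hp
          rw [map_zero, sub_self, zero_mul, hR, recSeq_conv_of_nonpos _ hQ le_rfl, neg_zero]
        · have hne := freq_sq_sub_ne_zero ht n (he0 hp)
          have hrec := recSeq_eq (fun p => d (e p) n t) hQ hp
          rw [hR, hrec, d_eq]
          field_simp
    refine ⟨Ψ, ?_, ?_⟩
    · rw [← freq_zero]; exact h1
    · rw [hnorm, h2, hR0]
  · intro Ψ hΨ x hx
    have heig := hΨ.isEigenfunction
    rw [← freq_zero] at heig
    have hs := heig.inDomain.summable_norm_coef ht n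
    have hser : ∀ x ∈ Icc (0 : ℝ) 1,
        HasSum (fun p => coef Ψ (freq n t p) * expo (freq n t p) x) (Ψ x) := fun x hx =>
      hasSum_coef_mul_expo heig.inDomain.continuousOn heig.inDomain.boundary hs.of_norm hx
    set Y : ℤ → ℂ := fun p => coef Ψ (freq n t (e p)) with hY
    have hYs : Summable fun p => ‖Y p‖ :=
      (e.toEquiv.summable_iff (f := fun p => ‖coef Ψ (freq n t p)‖)).2 hs
    have hY0 : Y 0 = 1 := by
      rw [hY]
      simp only [map_zero]
      rw [← hnorm, hΨ.normalized]
    have hrec : ∀ p ≠ 0, Y p = d (e p) n t * ∑' k, qCoeff q (e (p - k)) * Y k := by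
      intro p hp
      have h := heig.coef_eq hqi n (e p)
      rw [← (hasSum_coef_mul hqi hs hser (e p)).tsum_eq] at h
      rw [hconv (fun k => coef Ψ (freq n t k)) p, d_eq]
      have hne := freq_sq_sub_ne_zero ht n (he0 hp)
      field_simp
      linear_combination h
    have hneg := eq_zero_of_neg hQ hB hδ hYs hrec
    have hser' : HasSum (fun p => Y p * expo (freq n t (e p)) x) (Ψ x) :=
      (e.toEquiv.hasSum_iff (f := fun p => coef Ψ (freq n t p) * expo (freq n t p) x)).2
        (hser x hx)
    -- The term `p = 0` of the series is the exponential that the statement moves to the other side.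
    have hupd := hser'.update 0 0
    simp only [hY0, map_zero, freq_zero, one_mul, zero_sub] at hupd
    rw [neg_add_eq_sub, ← (Function.Injective.hasSum_iff (g := fun p : ℕ+ => (p : ℤ))
      (fun a b h => PNat.eq (by simpa using h)))] at hupd
    · convert! hupd using 2 with p
      have hp : (1 : ℤ) ≤ p := by have := p.pos; omega
      rw [Function.comp_apply, Function.update_of_ne (by omega),
        eq_recCoeff_of_pos hQ hneg hY0 hrec hp]
    · intro p hp
      rcases lt_trichotomy p 0 with h | rfl | h
      · rw [Function.update_of_ne h.ne, hneg p h, zero_mul]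
      · simp
      · exact absurd ⟨⟨p.toNat, by omega⟩, by simp; omega⟩ hp

theorem recTerm_eq_term (q : ℝ → ℂ) (t : ℂ) (n p : ℤ) {k : ℕ} (v : Fin k → ℤ) :
    recTerm (qCoeff q) (fun p => d p n t) p v = term q t n p v := by
  rw [recTerm, term, div_eq_mul_inv, ← Finset.prod_inv_distrib]
  congr 1
  refine Finset.prod_congr rfl fun s _ => ?_
  rw [d, ← inv_neg]
  congr 1
  push_cast; ring

theorem cPlus_eq_recCoeff (q : ℝ → ℂ) (t : ℂ) (n p : ℤ) :
    cPlus q t n p = recCoeff (qCoeff q) (fun p => d p n t) p := by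
  simp only [cPlus, recCoeff, recTerm_eq_term]

theorem recTerm_neg (Q δ : ℤ → ℂ) (p : ℤ) {k : ℕ} (v : Fin k → ℤ) :
    recTerm (fun m => Q (-m)) (fun m => δ (-m)) p v = recTerm Q δ (-p) (-v) := by
  simp only [recTerm, partialSum, Pi.neg_apply, Finset.sum_neg_distrib, neg_sub, sub_neg_eq_add,
    neg_add_eq_sub]

theorem cMinus_neg_eq_recCoeff (q : ℝ → ℂ) (t : ℂ) (n p : ℤ) :
    cMinus q t n (-p) = recCoeff (fun m => qCoeff q (-m)) (fun p => d (-p) n t) p := by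
  simp only [cMinus, recCoeff, recTerm_neg (qCoeff q) (fun p => d p n t), recTerm_eq_term,
    Int.natAbs_neg]
  congr 2
  refine Finset.sum_congr rfl fun k _ => ?_
  refine Finset.sum_nbij' (fun v => -v) (fun v => -v) (fun v hv => ?_) (fun v hv => ?_)
    (fun v _ => neg_neg v) (fun v _ => neg_neg v) (fun v _ => by rw [neg_neg])
  · obtain ⟨h1, h2⟩ := mem_negTuples.1 hv
    refine mem_posTuples.2 ⟨fun i => ?_, ?_⟩
    · rw [Pi.neg_apply]; linarith [h1 i]
    · simp only [Pi.neg_apply, Finset.sum_neg_distrib]; linarith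
  · obtain ⟨h1, h2⟩ := mem_posTuples.1 hv
    refine mem_negTuples.2 ⟨fun i => ?_, ?_⟩
    · rw [Pi.neg_apply]; linarith [h1 i]
    · simp only [Pi.neg_apply, Finset.sum_neg_distrib]; linarith

end Hill

end

theorem theorem2 (q : ℝ → ℂ) (t : ℂ) (ht : ∀ k : ℤ, t ≠ Real.pi * k) (n : ℤ) :
    (q ∈ Hill.L1Plus →
      (∃ Ψ : ℝ → ℂ, Hill.IsNormalizedEigenfunction q t n Ψ) ∧
      ∀ Ψ : ℝ → ℂ, Hill.IsNormalizedEigenfunction q t n Ψ →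
        ∀ x ∈ Set.Icc (0 : ℝ) 1,
          HasSum (fun p : ℕ+ =>
              Hill.cPlus q t n (p : ℤ) * Hill.expo (2 * Real.pi * (n + (p : ℤ)) + t) x)
            (Ψ x - Hill.expo (2 * Real.pi * n + t) x)) ∧
    (q ∈ Hill.L1Minus →
      (∃ Ψ : ℝ → ℂ, Hill.IsNormalizedEigenfunction q t n Ψ) ∧
      ∀ Ψ : ℝ → ℂ, Hill.IsNormalizedEigenfunction q t n Ψ →
        ∀ x ∈ Set.Icc (0 : ℝ) 1,
          HasSum (fun p : ℕ+ =>
              Hill.cMinus q t n (-(p : ℤ)) * Hill.expo (2 * Real.pi * (n + (-(p : ℤ) : ℤ)) + t) x)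
            (Ψ x - Hill.expo (2 * Real.pi * n + t) x)) := by
  refine ⟨fun hq => ?_, fun hq => ?_⟩
  · simpa only [Hill.cPlus_eq_recCoeff, Hill.freq, AddEquiv.refl_apply] using
      Hill.exists_normalizedEigenfunction_and_hasSum ht n (AddEquiv.refl ℤ) hq.1
        fun m hm => hq.2 m hm
  · simpa only [Hill.cMinus_neg_eq_recCoeff, Hill.freq, AddEquiv.neg_apply] using
      Hill.exists_normalizedEigenfunction_and_hasSum ht n (AddEquiv.neg ℤ) hq.1
        fun m hm => hq.2 (-m) (neg_nonneg.2 hm)
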